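/- Let $q$ be a complex number with $|q|<1$. For $a\in\mathbb{C}$, $p\in\mathbb{C}$ with $|p|<1$ and $n\ge 0$ put $(a;p)_n=\prod_{i=0}^{n-1}(1-ap^i)$ and $(a;p)_\infty=\prod_{i=0}^{\infty}(1-ap^i)$. Let $\mathcal{P}_4$ be the set of strict partitions, i.e. finite (possibly empty) sequences $\lambda=(\lambda_1>\lambda_2>\dots>\lambda_k)$ of positive integers, such that for consecutive parts $\lambda_i-\lambda_{i+1}\equiv 2\pmod 4$ if both are odd, $\lambda_i-\lambda_{i+1}\equiv 0\pmod 4$ if both are even, $\lambda_i-\lambda_{i+1}\equiv 3\pmod 4$ if they have different parity, and the smallest part (if $k\ge1$) is $\equiv 1$ or $2\pmod 4$. Let $o(\lambda)$ be the number of odd parts of $\lambda$ and $|\lambda|$ the sum of its parts. Then the two series below converge absolutely and $$\sum_{\lambda\in\mathcal{P}_4}(-1)^{o(\lambda)}q^{|\lambda|}=\sum_{n=0}^{\infty}\frac{(q;q^2)_n(-1)^nq^{n^2}}{(q^4;q^4)_n}=\frac{(q;q^6)_\infty(q^5;q^6)_\infty(q^6;q^{12})_\infty^2}{(q^2;q^6)_\infty(q^3;q^6)_\infty(q^4;q^6)_\infty}.$$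 -/

import Mathlib

namespace SlaterFour

/-- A partition: a non-increasing finite sequence of positive integers (the empty one included). -/
def IsPartition (l : List ℕ) : Prop :=
  l.SortedGE ∧ ∀ a ∈ l, 0 < a

/-- The gap condition between a part `a` and the next (smaller) part `b`. -/
def Gap (a b : ℕ) : Prop :=
  (Odd a ∧ Odd b → (a : ℤ) - b ≡ 2 [ZMOD 4]) ∧
  (Even a ∧ Even b → (a : ℤ) - b ≡ 0 [ZMOD 4]) ∧
  (¬ (Odd a ↔ Odd b) → (a : ℤ) - b ≡ 3 [ZMOD 4])

/-- The set `𝒫₄` of strict partitions in which consecutive parts satisfy the gap condition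
and whose smallest (that is, last) part, if there is one, is `1` or `2` modulo `4`. -/
def P4 : Set (List ℕ) :=
  {l | IsPartition l ∧ l.Nodup ∧ l.IsChain Gap ∧
    ∀ a ∈ l.getLast?, a ≡ 1 [MOD 4] ∨ a ≡ 2 [MOD 4]}

/-- The number `o(λ)` of odd parts. -/
def oddParts (l : List ℕ) : ℕ := l.countP (fun a => Odd a)

/-- The finite `q`-Pochhammer symbol `(a; q)_n`. -/
def qPoch (a q : ℂ) (n : ℕ) : ℂ := ∏ i ∈ Finset.range n, (1 - a * q ^ i)

/-- The infinite `q`-Pochhammer symbol `(a; q)_∞`, for `‖q‖ < 1`. -/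
noncomputable def qPochInf (a q : ℂ) : ℂ := ∏' i : ℕ, (1 - a * q ^ i)

theorem summable_neg_mul_pow (a : ℂ) {q : ℂ} (hq : ‖q‖ < 1) :
    Summable fun i : ℕ => ‖-(a * q ^ i)‖ := by
  simp only [norm_neg, norm_mul, norm_pow]
  exact (summable_geometric_of_lt_one (norm_nonneg q) hq).mul_left _

/-- The infinite product converges when `‖q‖ < 1`. -/
theorem multipliable_qPochInf (a : ℂ) {q : ℂ} (hq : ‖q‖ < 1) :
    Multipliable fun i : ℕ => 1 - a * q ^ i := by
  simpa [sub_eq_add_neg] using multipliable_one_add_of_summable (summable_neg_mul_pow a hq)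

/-- `(a; q)_∞` is the limit of `(a; q)_n`. -/
theorem tendsto_qPoch (a : ℂ) {q : ℂ} (hq : ‖q‖ < 1) :
    Filter.Tendsto (qPoch a q) Filter.atTop (nhds (qPochInf a q)) :=
  (multipliable_qPochInf a hq).hasProd.tendsto_prod_nat

theorem one_sub_pow_mul_ne_zero {q : ℂ} (hq : ‖q‖ < 1) {r : ℕ} (hr : r ≠ 0) (m i : ℕ) :
    1 - q ^ r * (q ^ m) ^ i ≠ 0 := by
  intro h
  have h1 : q ^ (r + m * i) = 1 := by
    rw [pow_add, pow_mul]
    exact (sub_eq_zero.mp h).symm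
  have h2 : ‖q‖ ^ (r + m * i) < 1 := pow_lt_one₀ (norm_nonneg q) hq (by omega)
  rw [← norm_pow, h1, norm_one] at h2
  exact lt_irrefl _ h2

/-- The finite denominators `(q^r; q^m)_n`, `r ≥ 1`, do not vanish. -/
theorem qPoch_ne_zero {q : ℂ} (hq : ‖q‖ < 1) {r : ℕ} (hr : r ≠ 0) (m n : ℕ) :
    qPoch (q ^ r) (q ^ m) n ≠ 0 :=
  Finset.prod_ne_zero_iff.mpr fun i _ => one_sub_pow_mul_ne_zero hq hr m i

/-- The infinite denominators `(q^r; q^m)_∞`, `r, m ≥ 1`, do not vanish. -/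
theorem qPochInf_ne_zero {q : ℂ} (hq : ‖q‖ < 1) {r m : ℕ} (hr : r ≠ 0) (hm : m ≠ 0) :
    qPochInf (q ^ r) (q ^ m) ≠ 0 := by
  have hqm : ‖q ^ m‖ < 1 := by
    rw [norm_pow]
    exact pow_lt_one₀ (norm_nonneg q) hq hm
  have h := tprod_one_add_ne_zero_of_summable
    (f := fun i : ℕ => -(q ^ r * (q ^ m) ^ i))
    (fun i => by
      simpa [sub_eq_add_neg] using one_sub_pow_mul_ne_zero hq hr m i)
    (summable_neg_mul_pow _ hqm)
  simpa [qPochInf, sub_eq_add_neg] using h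

end SlaterFour

/-! Reading a partition of `P4` from its smallest part upwards, each part has a parity and a slack
`m`: two neighbours differ by the least positive amount their parities allow plus `4 * m`. These
data are arbitrary, so `P4` is in bijection with lists over `Bool × ℕ` (`decodeEquiv`). Enlarging a
part pushes up all the larger parts, so the signed weight is a product of factors depending only on
position. Summing over lists of length `k` gives the `k`-th term of the series (`tsum_weight`,
`prod_partSum`).

The product formula follows Bailey's method with `Q = q ^ 2`. The factor `1 / (q^4;q^4)_n` is
expanded as a sum over `r : ℤ` of `(-1)^r Q^(r^2) / ((Q;Q)_{n-r} (Q;Q)_{n+r})`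
(`baileySum_natCast`). After exchanging the sums, the sum over `n` is `(-1)^r q^(r^2)` times a
constant (`conjSum_eq`). What remains is the theta series of `q ^ (3 * r^2)`, evaluated by the
Jacobi triple product (`tsum_pow_sq`). Both finite sums and the sum over `n` are handled by
recurrences with shifted or telescoping terms. -/

namespace SlaterFour

open Filter Topology

/-! ### Encoding of `P4` by parities and slacks -/

/-- The least part size `1` or `2` with the parity of an encoded part. -/
def minPart (b : Bool) : ℕ := if b then 1 else 2

/-- The amount by which an encoded tail shifts the part placed in front of it. -/
def shift : List (Bool × ℕ) → ℕ
  | [] => 0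
  | x :: xs => 2 * minPart x.1 + 4 * x.2 + shift xs

/-- The list of parts encoded by parities and slacks. -/
def decode : List (Bool × ℕ) → List ℕ
  | [] => []
  | x :: xs => (minPart x.1 + 4 * x.2 + shift xs) :: decode xs

theorem minPart_pos (b : Bool) : 0 < minPart b := by cases b <;> simp [minPart]

theorem shift_even (xs : List (Bool × ℕ)) : Even (shift xs) := by
  induction xs with
  | nil => simp [shift]
  | cons x xs ih =>
    obtain ⟨c, hc⟩ := ih
    exact ⟨minPart x.1 + 2 * x.2 + c, by simp only [shift]; omega⟩

theorem odd_head_iff (x : Bool × ℕ) (xs : List (Bool × ℕ)) :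
    Odd (minPart x.1 + 4 * x.2 + shift xs) ↔ x.1 = true := by
  obtain ⟨c, hc⟩ := shift_even xs
  rcases x with ⟨_ | _, m⟩ <;> simp only [minPart, Nat.odd_iff, hc] <;> simp <;> omega

theorem le_shift_of_mem_decode (xs : List (Bool × ℕ)) : ∀ b ∈ decode xs, b ≤ shift xs := by
  induction xs with
  | nil => simp [decode]
  | cons x xs ih =>
    intro b hb
    simp only [decode, List.mem_cons] at hb
    simp only [shift]
    rcases hb with rfl | hb
    · omega
    · have := ih b hb
      omega

theorem decode_pairwise (xs : List (Bool × ℕ)) : (decode xs).Pairwise (· > ·) := by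
  induction xs with
  | nil => simp [decode]
  | cons x xs ih =>
    simp only [decode, List.pairwise_cons]
    refine ⟨fun b hb => ?_, ih⟩
    have := le_shift_of_mem_decode xs b hb
    have := minPart_pos x.1
    omega

/-- The least positive differences are 2 (both odd), 4 (both even) and 3 (mixed), each the sum of
the two `minPart`s. Strictness `b < a` excludes the difference 0 of two even parts. -/
theorem gap_iff (a b : ℕ) (hab : b < a) :
    Gap a b ↔ ∃ m, a = b + minPart (decide (Odd a)) + minPart (decide (Odd b)) + 4 * m := by
  unfold Gap
  rw [← Nat.not_odd_iff_even, ← Nat.not_odd_iff_even]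
  simp only [Int.modEq_iff_dvd]
  by_cases ha : Odd a <;> by_cases hb : Odd b <;> simp [ha, hb, minPart] <;>
    constructor <;> intro h
  -- With remainder 2, 3 or 4 beyond `4 * m`, subtracting 2 and dividing by 4 always returns `m`.
  all_goals first
    | exact ⟨(a - b - 2) / 4, by omega⟩
    | (obtain ⟨m, hm⟩ := h; omega)

theorem decode_isChain (xs : List (Bool × ℕ)) : (decode xs).IsChain Gap := by
  induction xs with
  | nil => simp [decode]
  | cons x xs ih =>
    cases xs with
    | nil => simp [decode]
    | cons y ys =>
      simp only [decode, List.isChain_cons_cons] at ih ⊢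
      refine ⟨?_, ih⟩
      have := minPart_pos x.1
      rw [gap_iff _ _ (by simp only [shift]; omega)]
      have h1 := odd_head_iff x (y :: ys)
      have h2 := odd_head_iff y ys
      simp only [h1, h2, Bool.decide_eq_true]
      -- The shift of a nonempty tail is its head plus the `minPart` of that head, so the slack of
      -- the gap is `x.2`.
      exact ⟨x.2, by simp only [shift]; ring⟩

theorem decode_getLast (xs : List (Bool × ℕ)) :
    ∀ a ∈ (decode xs).getLast?, a ≡ 1 [MOD 4] ∨ a ≡ 2 [MOD 4] := by
  induction xs with
  | nil => simp [decode]
  | cons x xs ih =>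
    cases xs with
    | nil =>
      rcases x with ⟨_ | _, m⟩ <;> simp [decode, shift, minPart, Nat.ModEq]
    | cons y ys =>
      simp only [decode, List.getLast?_cons_cons] at ih ⊢
      exact ih

theorem decode_mem (xs : List (Bool × ℕ)) : decode xs ∈ P4 := by
  have hp := decode_pairwise xs
  refine ⟨⟨(hp.imp fun h => le_of_lt h).sortedGE, fun a ha => ?_⟩,
    hp.imp fun h => ne_of_gt h, decode_isChain xs, decode_getLast xs⟩
  induction xs with
  | nil => simp [decode] at ha
  | cons x xs ih =>
    simp only [decode, List.mem_cons] at ha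
    rcases ha with rfl | ha
    · have := minPart_pos x.1
      omega
    · exact ih (decode_pairwise xs) ha

theorem decode_injective : Function.Injective decode := by
  intro xs
  induction xs with
  | nil => rintro (_ | ⟨y, ys⟩) h <;> simp_all [decode]
  | cons x xs ih =>
    rintro (_ | ⟨y, ys⟩) h
    · simp [decode] at h
    · simp only [decode, List.cons.injEq] at h
      obtain rfl := ih h.2
      have h1 := h.1
      rcases x with ⟨_ | _, m⟩ <;> rcases y with ⟨_ | _, m'⟩ <;> simp [minPart] at h1 ⊢ <;> omega

theorem exists_decode_eq (l : List ℕ) (hl : l ∈ P4) : ∃ xs, decode xs = l := by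
  induction l with
  | nil => exact ⟨[], rfl⟩
  | cons a l ih =>
    obtain ⟨⟨hs, hpos⟩, hnd, hc, hlast⟩ := hl
    cases l with
    | nil =>
      have h := hlast a (by simp)
      simp only [Nat.ModEq] at h
      rcases h with h | h
      · exact ⟨[(true, a / 4)], by simp [decode, minPart, shift]; omega⟩
      · exact ⟨[(false, a / 4)], by simp [decode, minPart, shift]; omega⟩
    | cons b l =>
      have hs' := hs.pairwise
      rw [List.pairwise_cons] at hs'
      rw [List.nodup_cons] at hnd
      rw [List.isChain_cons_cons] at hc
      obtain ⟨xs, hxs⟩ := ih ⟨⟨hs'.2.sortedGE, fun c hc => hpos c (List.mem_cons_of_mem _ hc)⟩,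
        hnd.2, hc.2, by simpa using hlast⟩
      cases xs with
      | nil => simp [decode] at hxs
      | cons y ys =>
        have hba : b < a := lt_of_le_of_ne (hs'.1 b (by simp)) fun h => hnd.1 (by simp [h])
        obtain ⟨m, hm⟩ := (gap_iff a b hba).1 hc.1
        refine ⟨(decide (Odd a), m) :: y :: ys, ?_⟩
        rw [decode, hxs]
        simp only [decode, List.cons.injEq] at hxs
        have h2 := odd_head_iff y ys
        rw [hxs.1] at h2
        have hy : decide (Odd b) = y.1 := by simp [h2]
        rw [hy] at hm
        congr 1
        simp only [shift]
        have := hxs.1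
        omega

/-- Partitions in `𝒫₄` correspond to lists of parities and slacks. -/
noncomputable def decodeEquiv : List (Bool × ℕ) ≃ P4 :=
  Equiv.ofBijective (fun xs => ⟨decode xs, decode_mem xs⟩)
    ⟨fun _ _ h => decode_injective (congrArg Subtype.val h), fun l => by
      obtain ⟨xs, h⟩ := exists_decode_eq l.1 l.2
      exact ⟨xs, Subtype.ext h⟩⟩

/-! ### Generating function of encoded partitions -/

section Weight

variable {𝕜 : Type*} [NormedField 𝕜]

/-- The weight of one encoded part in front of which `i` parts stand. -/
def partWeight (s q : 𝕜) (i : ℕ) (x : Bool × ℕ) : 𝕜 :=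
  (if x.1 then s else 1) * q ^ ((2 * i + 1) * minPart x.1 + 4 * (i + 1) * x.2)

/-- The weight of an encoded partition in front of which `i` parts stand. -/
def weight (s q : 𝕜) : ℕ → List (Bool × ℕ) → 𝕜
  | _, [] => 1
  | i, x :: xs => partWeight s q i x * weight s q (i + 1) xs

/-- Each of the `i` parts in front is raised by `shift xs`, which accounts for the term `i * shift
xs`. -/
theorem weight_eq (s q : 𝕜) (i : ℕ) (xs : List (Bool × ℕ)) :
    weight s q i xs = s ^ oddParts (decode xs) * q ^ ((decode xs).sum + i * shift xs) := by
  induction xs generalizing i with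
  | nil => simp [weight, decode, oddParts, shift]
  | cons x xs ih =>
    have h := odd_head_iff x xs
    rw [weight, ih, partWeight]
    simp only [decode, oddParts, List.countP_cons, List.sum_cons, shift, h, decide_eq_true_eq]
    rcases x with ⟨_ | _, m⟩ <;> simp [minPart] <;> ring

/-- Norms of weights are weights over `ℝ`, so absolute convergence follows from the same product
evaluation at `‖s‖`, `‖q‖`. -/
theorem norm_weight (s q : 𝕜) (i : ℕ) (xs : List (Bool × ℕ)) :
    ‖weight s q i xs‖ = weight ‖s‖ ‖q‖ i xs := by
  simp [weight_eq]

/-- The sum of the weights of one part. -/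
def partSum (s q : 𝕜) (i : ℕ) : 𝕜 :=
  (s * q ^ (2 * i + 1) + q ^ (4 * i + 2)) / (1 - q ^ (4 * i + 4))

theorem summable_norm_partWeight (s : 𝕜) {q : 𝕜} (hq : ‖q‖ < 1) (i : ℕ) :
    Summable fun x => ‖partWeight s q i x‖ := by
  have hr : ‖q‖ ^ (4 * i + 4) < 1 := pow_lt_one₀ (norm_nonneg q) hq (by omega)
  have hg := summable_geometric_of_lt_one (by positivity) hr
  rw [summable_prod_of_nonneg fun _ => norm_nonneg _]
  refine ⟨fun b => ?_, Summable.of_finite⟩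
  refine (hg.mul_left (‖(if b then s else 1 : 𝕜)‖ * ‖q‖ ^ ((2 * i + 1) * minPart b))).congr
    fun m => ?_
  simp only [partWeight, norm_mul, norm_pow]
  ring

theorem hasSum_partWeight [CompleteSpace 𝕜] (s : 𝕜) {q : 𝕜} (hq : ‖q‖ < 1) (i : ℕ) :
    HasSum (partWeight s q i) (partSum s q i) := by
  have hr : ‖q ^ (4 * i + 4)‖ < 1 := by
    rw [norm_pow]; exact pow_lt_one₀ (norm_nonneg q) hq (by omega)
  have hg := hasSum_geometric_of_norm_lt_one hr
  have hs := (summable_norm_partWeight s hq i).of_norm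
  have hb (b : Bool) : HasSum (fun m => partWeight s q i (b, m))
      ((if b then s else 1) * q ^ ((2 * i + 1) * minPart b) * (1 - q ^ (4 * i + 4))⁻¹) := by
    refine (hg.mul_left _).congr_fun fun m => ?_
    simp only [partWeight]
    ring
  have h := (hs.hasSum.prod_fiberwise hb).unique (hasSum_fintype _)
  have hp : partSum s q i = ∑' x, partWeight s q i x := by
    rw [h, partSum, Fintype.sum_bool]
    simp only [minPart, if_true, Bool.false_eq_true, if_false]
    ring
  rw [hp]
  exact hs.hasSum

/-- Splitting off the head turns the sum into a product of two absolutely convergent sums, with the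
tail starting at position `i + 1`. -/
theorem weight_ofFn [CompleteSpace 𝕜] (s : 𝕜) {q : 𝕜} (hq : ‖q‖ < 1) (k i : ℕ) :
    Summable (fun v : Fin k → Bool × ℕ => ‖weight s q i (List.ofFn v)‖) ∧
    HasSum (fun v : Fin k → Bool × ℕ => weight s q i (List.ofFn v))
      (∏ j ∈ Finset.range k, partSum s q (i + j)) := by
  induction k generalizing i with
  | zero =>
    refine ⟨Summable.of_finite, ?_⟩
    simp [weight]
  | succ k ih =>
    obtain ⟨h1, h2⟩ := ih (i + 1)
    have hn := summable_norm_partWeight s hq i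
    have key : ∀ x : (Bool × ℕ) × (Fin k → Bool × ℕ),
        weight s q i (List.ofFn (Fin.consEquiv (fun _ : Fin (k + 1) => Bool × ℕ) x)) =
          partWeight s q i x.1 * weight s q (i + 1) (List.ofFn x.2) := by
      intro x
      simp [Fin.consEquiv, weight]
    constructor
    · rw [← (Fin.consEquiv fun _ : Fin (k + 1) => Bool × ℕ).summable_iff]
      refine (summable_mul_of_summable_norm (f := fun x => ‖partWeight s q i x‖)
        (g := fun v : Fin k → Bool × ℕ => ‖weight s q (i + 1) (List.ofFn v)‖)
        (by simpa using hn) (by simpa using h1)).congr fun x => ?_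
      rw [Function.comp_apply, key, norm_mul]
    · rw [← (Fin.consEquiv fun _ : Fin (k + 1) => Bool × ℕ).hasSum_iff]
      have hm := summable_mul_of_summable_norm (f := partWeight s q i)
        (g := fun v : Fin k → Bool × ℕ => weight s q (i + 1) (List.ofFn v)) hn h1
      have h := (hasSum_partWeight s hq i).mul h2 hm
      have hp : ∏ j ∈ Finset.range (k + 1), partSum s q (i + j) =
          partSum s q i * ∏ j ∈ Finset.range k, partSum s q (i + 1 + j) := by
        rw [Finset.prod_range_succ', mul_comm]
        simp [add_assoc, add_comm 1]
      rw [hp]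
      exact h.congr_fun fun x => key x

theorem tendsto_norm_partSum (s : 𝕜) {q : 𝕜} (hq : ‖q‖ < 1) :
    Tendsto (fun i => ‖partSum s q i‖) atTop (𝓝 0) := by
  have h (c d : ℕ) : Tendsto (fun i => q ^ ((c + 1) * i + d)) atTop (𝓝 0) := by
    refine (tendsto_pow_atTop_nhds_zero_of_norm_lt_one hq).comp ?_
    exact tendsto_atTop_mono (fun i => by simp only [id]; nlinarith) tendsto_id
  have := (((h 1 1).const_mul s).add (h 3 2)).div ((h 3 4).const_sub 1) (by simp)
  simpa [partSum] using this.norm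

/-- The products counting the partitions with a given number of parts are summable. -/
theorem summable_norm_prod_partSum (s : 𝕜) {q : 𝕜} (hq : ‖q‖ < 1) :
    Summable fun k => ‖∏ j ∈ Finset.range k, partSum s q j‖ := by
  have hev : ∀ᶠ k in atTop, ‖partSum s q k‖ ≤ 1 / 2 :=
    (tendsto_norm_partSum s hq).eventually (eventually_le_nhds (by norm_num))
  refine summable_of_ratio_norm_eventually_le (r := 1 / 2) (by norm_num) ?_
  filter_upwards [hev] with k hk
  rw [Finset.prod_range_succ, norm_norm, norm_norm, norm_mul, mul_comm]
  exact mul_le_mul_of_nonneg_right hk (norm_nonneg _)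

end Weight

theorem summable_norm_weight {𝕜 : Type*} [NormedField 𝕜] [CompleteSpace 𝕜] (s : 𝕜) {q : 𝕜}
    (hq : ‖q‖ < 1) : Summable fun xs => ‖weight s q 0 xs‖ := by
  rw [← List.equivSigmaTuple.symm.summable_iff]
  refine (summable_sigma_of_nonneg fun x => norm_nonneg (weight s q 0 _)).2 ?_
  refine ⟨fun k => (weight_ofFn s hq k 0).1, ?_⟩
  have hq' : ‖‖q‖‖ < 1 := by simpa using hq
  refine (summable_norm_prod_partSum ‖s‖ hq').of_norm.congr fun k => ?_
  have h := (weight_ofFn ‖s‖ hq' k 0).2.tsum_eq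
  simp only [zero_add] at h
  rw [← h]
  simp [List.equivSigmaTuple, norm_weight]

theorem tsum_weight {𝕜 : Type*} [NormedField 𝕜] [CompleteSpace 𝕜] (s : 𝕜) {q : 𝕜}
    (hq : ‖q‖ < 1) :
    ∑' xs, weight s q 0 xs = ∑' k, ∏ j ∈ Finset.range k, partSum s q j := by
  rw [← List.equivSigmaTuple.symm.tsum_eq, Summable.tsum_sigma]
  · congr 1 with k
    have h := (weight_ofFn s hq k 0).2.tsum_eq
    simp only [zero_add] at h
    rw [← h]
    rfl
  · exact (List.equivSigmaTuple.symm.summable_iff (f := weight s q 0)).2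
      (summable_norm_weight s hq).of_norm

/-- At `s = -1` the numerator of `partSum` factors as `-q^(2j+1) * (1 - q^(2j+1))`. -/
theorem prod_partSum (q : ℂ) (k : ℕ) :
    ∏ j ∈ Finset.range k, partSum (-1) q j =
      qPoch q (q ^ 2) k * (-1) ^ k * q ^ k ^ 2 / qPoch (q ^ 4) (q ^ 4) k := by
  induction k with
  | zero => simp [qPoch]
  | succ k ih =>
    rw [Finset.prod_range_succ, ih, partSum, div_mul_div_comm]
    simp only [qPoch, Finset.prod_range_succ]
    congr 1 <;> ring

theorem summable_slaterTerm {q : ℂ} (hq : ‖q‖ < 1) :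
    Summable fun n : ℕ =>
      qPoch q (q ^ 2) n * (-1) ^ n * q ^ n ^ 2 / qPoch (q ^ 4) (q ^ 4) n :=
  (summable_norm_prod_partSum (-1) hq).of_norm.congr fun k => prod_partSum q k

theorem weight_decodeEquiv_symm (q : ℂ) (l : P4) :
    (-1 : ℂ) ^ oddParts (l : List ℕ) * q ^ (l : List ℕ).sum =
      weight (-1) q 0 (decodeEquiv.symm l) := by
  obtain ⟨xs, rfl⟩ := decodeEquiv.surjective l
  rw [Equiv.symm_apply_apply, weight_eq, zero_mul, add_zero]
  rfl

theorem summable_partitions {q : ℂ} (hq : ‖q‖ < 1) :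
    Summable fun l : P4 => (-1 : ℂ) ^ oddParts (l : List ℕ) * q ^ (l : List ℕ).sum := by
  simp only [weight_decodeEquiv_symm]
  exact (decodeEquiv.symm.summable_iff (f := weight (-1) q 0)).2
    (summable_norm_weight (-1) hq).of_norm

theorem tsum_partitions {q : ℂ} (hq : ‖q‖ < 1) :
    ∑' l : P4, (-1 : ℂ) ^ oddParts (l : List ℕ) * q ^ (l : List ℕ).sum =
      ∑' n : ℕ, qPoch q (q ^ 2) n * (-1) ^ n * q ^ n ^ 2 / qPoch (q ^ 4) (q ^ 4) n := by
  simp only [weight_decodeEquiv_symm]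
  rw [decodeEquiv.symm.tsum_eq (weight (-1) q 0), tsum_weight _ hq]
  simp only [prod_partSum]

/-! ### Reciprocal Pochhammer symbols with integer index -/

/-- The reciprocal of `(q; q)_m`, extended by zero to negative `m`. -/
noncomputable def invPoch (q : ℂ) (m : ℤ) : ℂ := if m < 0 then 0 else (qPoch q q m.toNat)⁻¹

theorem invPoch_natCast (q : ℂ) (n : ℕ) : invPoch q n = (qPoch q q n)⁻¹ := by
  simp [invPoch]

theorem invPoch_of_neg (q : ℂ) {m : ℤ} (hm : m < 0) : invPoch q m = 0 := by
  simp [invPoch, hm]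

theorem qPoch_self_ne_zero {q : ℂ} (hq : ‖q‖ < 1) (n : ℕ) : qPoch q q n ≠ 0 := by
  simpa using qPoch_ne_zero hq one_ne_zero 1 n

theorem qPochInf_self_ne_zero {q : ℂ} (hq : ‖q‖ < 1) : qPochInf q q ≠ 0 := by
  simpa using qPochInf_ne_zero hq one_ne_zero one_ne_zero

/-- At `m = 0` both sides vanish, so extension by zero makes the recurrence valid on all of `ℤ` and
later sums over `ℤ` have no boundary terms. -/
theorem invPoch_sub_one {q : ℂ} (hq : ‖q‖ < 1) (m : ℤ) :
    invPoch q (m - 1) = (1 - q ^ m) * invPoch q m := by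
  rcases lt_trichotomy m 0 with hm | rfl | hm
  · simp [invPoch_of_neg q hm, invPoch_of_neg q (show m - 1 < 0 by omega)]
  · simp [invPoch_of_neg]
  · obtain ⟨n, rfl⟩ : ∃ n : ℕ, m = n + 1 := ⟨(m - 1).toNat, by omega⟩
    have h := qPoch_self_ne_zero hq (n + 1)
    have h' := qPoch_self_ne_zero hq n
    have e : qPoch q q (n + 1) = qPoch q q n * (1 - q * q ^ n) := by
      simp [qPoch, Finset.prod_range_succ]
    rw [add_sub_cancel_right, invPoch_natCast, ← Nat.cast_succ, invPoch_natCast, Nat.succ_eq_add_one,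
      zpow_natCast]
    field_simp
    rw [e]; ring

theorem tendsto_invPoch {q : ℂ} (hq : ‖q‖ < 1) :
    Tendsto (fun n : ℕ => invPoch q n) atTop (𝓝 (qPochInf q q)⁻¹) := by
  simp only [invPoch_natCast]
  exact (tendsto_qPoch q hq).inv₀ (qPochInf_self_ne_zero hq)

theorem exists_invPoch_bound {q : ℂ} (hq : ‖q‖ < 1) : ∃ B : ℝ, ∀ m, ‖invPoch q m‖ ≤ B := by
  obtain ⟨B, hB⟩ := (tendsto_invPoch hq).norm.bddAbove_range
  refine ⟨B, fun m => ?_⟩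
  have h (n : ℕ) : ‖invPoch q n‖ ≤ B := hB ⟨n, rfl⟩
  rcases lt_or_ge m 0 with hm | hm
  · rw [invPoch_of_neg q hm, norm_zero]
    exact (norm_nonneg _).trans (h 0)
  · lift m to ℕ using hm
    exact h m

theorem summable_mul_invPoch (q : ℂ) (f : ℤ → ℂ) (n m : ℤ) :
    Summable fun r => f r * (invPoch q (n - r) * invPoch q (m + r)) := by
  refine summable_of_hasFiniteSupport ((Set.finite_Icc (-m) n).subset fun r hr => ?_)
  by_contra h
  apply hr
  rw [Set.mem_Icc, not_and_or] at h
  rcases h with h | h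
  · simp [invPoch_of_neg q (show m + r < 0 by omega)]
  · simp [invPoch_of_neg q (show n - r < 0 by omega)]

theorem norm_sq_lt_one {q : ℂ} (hq : ‖q‖ < 1) : ‖q ^ 2‖ < 1 := by
  rw [norm_pow]; exact pow_lt_one₀ (norm_nonneg q) hq two_ne_zero

/-! ### Jacobi triple product -/

/-- The two-index form of the finite Jacobi triple product. -/
noncomputable def thetaSum (p : ℂ) (n m : ℤ) : ℂ :=
  ∑' r : ℤ, p ^ (r ^ 2) * (invPoch (p ^ 2) (n - r) * invPoch (p ^ 2) (m + r))

theorem thetaSum_comm (p : ℂ) (n m : ℤ) : thetaSum p n m = thetaSum p m n := by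
  rw [thetaSum, ← (Equiv.neg ℤ).tsum_eq, thetaSum]
  refine tsum_congr fun r => ?_
  simp only [Equiv.neg_apply, neg_sq, sub_neg_eq_add, ← sub_eq_add_neg]
  ring

/-- With `x = Q^(n+1-r)`, `y = Q^(m+r)` and `Q = p ^ 2`, one has `1 - x * y = (1 - x) + x * (1 -
y)`. The first piece gives the summand at `(n, m)`, the second its translate by `r ↦ r - 1`. -/
theorem thetaSum_step {p : ℂ} (hp : ‖p‖ < 1) (hp0 : p ≠ 0) (n m : ℤ) :
    (1 - (p ^ 2) ^ (n + m + 1)) * thetaSum p (n + 1) m =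
      (1 + p ^ (2 * n + 1)) * thetaSum p n m := by
  have hQ := norm_sq_lt_one hp
  have hQ0 : p ^ 2 ≠ 0 := pow_ne_zero 2 hp0
  have s1 := summable_mul_invPoch (p ^ 2) (fun r => p ^ (r ^ 2)) n m
  have key (r : ℤ) : (1 - (p ^ 2) ^ (n + m + 1)) *
      (p ^ (r ^ 2) * (invPoch (p ^ 2) (n + 1 - r) * invPoch (p ^ 2) (m + r))) =
      p ^ (r ^ 2) * (invPoch (p ^ 2) (n - r) * invPoch (p ^ 2) (m + r)) +
      p ^ (2 * n + 1) * (p ^ ((r - 1) ^ 2) *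
        (invPoch (p ^ 2) (n - (r - 1)) * invPoch (p ^ 2) (m + (r - 1)))) := by
    have a1 := invPoch_sub_one hQ (n + 1 - r)
    have a2 := invPoch_sub_one hQ (m + r)
    rw [show n + 1 - r - 1 = n - r by ring] at a1
    rw [show n - (r - 1) = n + 1 - r by ring, show m + (r - 1) = m + r - 1 by ring, a1, a2]
    have e1 : (p ^ 2) ^ (n + m + 1) = (p ^ 2) ^ (n + 1 - r) * (p ^ 2) ^ (m + r) := by
      rw [← zpow_add₀ hQ0]; congr 1; ring
    have e2 : p ^ (2 * n + 1) * p ^ ((r - 1) ^ 2) = p ^ (r ^ 2) * (p ^ 2) ^ (n + 1 - r) := by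
      rw [← zpow_natCast, ← zpow_mul, ← zpow_add₀ hp0, ← zpow_add₀ hp0]
      congr 1; push_cast; ring
    rw [← mul_assoc (p ^ (2 * n + 1)), e2, e1]
    ring
  have hs := (Equiv.subRight (1 : ℤ)).tsum_eq
    (fun r => p ^ (r ^ 2) * (invPoch (p ^ 2) (n - r) * invPoch (p ^ 2) (m + r)))
  have s2 : Summable fun r : ℤ => p ^ ((r - 1) ^ 2) *
      (invPoch (p ^ 2) (n - (r - 1)) * invPoch (p ^ 2) (m + (r - 1))) :=
    (Equiv.subRight (1 : ℤ)).summable_iff.2 s1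
  simp only [Equiv.subRight_apply] at hs
  rw [thetaSum, ← tsum_mul_left, tsum_congr key, s1.tsum_add (s2.mul_left _), tsum_mul_left, hs,
    thetaSum]
  ring

theorem thetaSum_self {p : ℂ} (hp : ‖p‖ < 1) (hp0 : p ≠ 0) (n : ℕ) :
    thetaSum p n n = qPoch (-p) (p ^ 2) n ^ 2 / qPoch (p ^ 2) (p ^ 2) (2 * n) := by
  have hQ := norm_sq_lt_one hp
  induction n with
  | zero =>
    rw [thetaSum, tsum_eq_single 0]
    · simp [invPoch, qPoch]
    · intro r hr
      rcases lt_or_gt_of_ne hr with h | h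
      · simp [invPoch_of_neg _ h]
      · simp [invPoch_of_neg _ (show -r < 0 by omega)]
  | succ n ih =>
    have h1 := thetaSum_step hp hp0 n n
    have h2 := thetaSum_step hp hp0 n (n + 1)
    -- Symmetry lets the same step raise the second index, going from `(n, n)` through `(n + 1, n)`
    -- to `(n + 1, n + 1)`.
    rw [thetaSum_comm p n] at h2
    have hd := qPoch_self_ne_zero hQ (2 * (n + 1))
    have hd' := qPoch_self_ne_zero hQ (2 * n)
    have e : qPoch (p ^ 2) (p ^ 2) (2 * (n + 1)) = qPoch (p ^ 2) (p ^ 2) (2 * n) *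
        (1 - (p ^ 2) ^ (2 * n + 1)) * (1 - (p ^ 2) ^ (2 * n + 2)) := by
      simp only [qPoch, mul_add, mul_one, Finset.prod_range_succ]
      ring
    have e' : qPoch (-p) (p ^ 2) (n + 1) = qPoch (-p) (p ^ 2) n * (1 + p ^ (2 * n + 1)) := by
      simp only [qPoch, Finset.prod_range_succ]
      ring
    have z1 : (p ^ 2) ^ ((n : ℤ) + n + 1) = (p ^ 2) ^ (2 * n + 1) := by
      rw [← zpow_natCast (p ^ 2) (2 * n + 1)]; congr 1; push_cast; ring
    have z2 : (p ^ 2) ^ ((n : ℤ) + (n + 1) + 1) = (p ^ 2) ^ (2 * n + 2) := by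
      rw [← zpow_natCast (p ^ 2) (2 * n + 2)]; congr 1; push_cast; ring
    have z3 : p ^ (2 * (n : ℤ) + 1) = p ^ (2 * n + 1) := by
      rw [← zpow_natCast p (2 * n + 1)]; congr 1
    rw [z1, z3, ih] at h1
    rw [z2, z3] at h2
    rw [Nat.cast_add, Nat.cast_one, eq_div_iff hd, e, e']
    have h3 : qPoch (-p) (p ^ 2) n ^ 2 / qPoch (p ^ 2) (p ^ 2) (2 * n) *
      qPoch (p ^ 2) (p ^ 2) (2 * n) = qPoch (-p) (p ^ 2) n ^ 2 := div_mul_cancel₀ _ hd'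
    linear_combination (qPoch (p ^ 2) (p ^ 2) (2 * n) * (1 - (p ^ 2) ^ (2 * n + 1))) * h2 +
      (qPoch (p ^ 2) (p ^ 2) (2 * n) * (1 + p ^ (2 * n + 1))) * h1 +
      (1 + p ^ (2 * n + 1)) ^ 2 * h3

theorem summable_norm_pow_sq {p : ℂ} (hp : ‖p‖ < 1) : Summable fun r : ℤ => ‖p ^ (r ^ 2)‖ := by
  have h : Summable fun n : ℕ => ‖p ^ ((n : ℤ) ^ 2)‖ := by
    refine (summable_geometric_of_lt_one (norm_nonneg p) hp).of_nonneg_of_le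
      (fun _ => norm_nonneg _) fun n => ?_
    rw [← Nat.cast_pow, zpow_natCast, norm_pow]
    exact pow_le_pow_of_le_one (norm_nonneg p) hp.le (Nat.le_self_pow two_ne_zero n)
  exact Summable.of_nat_of_neg h (by simpa using h)

theorem tendsto_invPoch_add {q : ℂ} (hq : ‖q‖ < 1) (r : ℤ) :
    Tendsto (fun n : ℕ => invPoch q (n + r)) atTop (𝓝 (qPochInf q q)⁻¹) := by
  have h : Tendsto (invPoch q) atTop (𝓝 (qPochInf q q)⁻¹) := by
    rw [← Nat.map_cast_int_atTop]
    exact tendsto_map'_iff.2 (tendsto_invPoch hq)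
  exact h.comp (tendsto_atTop_add_const_right _ _ tendsto_natCast_atTop_atTop)

/-- A case of the Jacobi triple product. -/
theorem tsum_pow_sq {p : ℂ} (hp : ‖p‖ < 1) (hp0 : p ≠ 0) :
    ∑' r : ℤ, p ^ (r ^ 2) = qPochInf (-p) (p ^ 2) ^ 2 * qPochInf (p ^ 2) (p ^ 2) := by
  have hQ := norm_sq_lt_one hp
  obtain ⟨B, hB⟩ := exists_invPoch_bound hQ
  have h1 : Tendsto (fun n : ℕ => thetaSum p n n) atTop
      (𝓝 (∑' r : ℤ, p ^ (r ^ 2) * ((qPochInf (p ^ 2) (p ^ 2))⁻¹ *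
        (qPochInf (p ^ 2) (p ^ 2))⁻¹))) := by
    refine tendsto_tsum_of_dominated_convergence
      ((summable_norm_pow_sq hp).mul_right (B * B)) (fun r => ?_) (.of_forall fun n r => ?_)
    · exact ((tendsto_invPoch_add hQ (-r)).mul (tendsto_invPoch_add hQ r)).const_mul _
    · rw [norm_mul, norm_mul]
      gcongr
      · exact (norm_nonneg _).trans (hB 0)
      · exact hB _
      · exact hB _
  have h2 : Tendsto (fun n : ℕ => thetaSum p n n) atTop
      (𝓝 (qPochInf (-p) (p ^ 2) ^ 2 / qPochInf (p ^ 2) (p ^ 2))) := by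
    simp only [thetaSum_self hp hp0]
    refine ((tendsto_qPoch _ hQ).pow 2).div ?_ (qPochInf_self_ne_zero hQ)
    exact (tendsto_qPoch _ hQ).comp (tendsto_id.const_mul_atTop' two_pos)
  have h := tendsto_nhds_unique h1 h2
  have h0 := qPochInf_self_ne_zero hQ
  rw [tsum_mul_right] at h
  field_simp at h
  rw [h, mul_comm]

/-! ### Bailey pair -/

/-- The left-hand side of the Bailey pair identity. -/
noncomputable def baileySum (Q : ℂ) (n : ℤ) : ℂ :=
  ∑' r : ℤ, (-1) ^ r * Q ^ (r ^ 2) * (invPoch Q (n - r) * invPoch Q (n + r))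

/-- With `x = Q^(n+1-r)` and `y = Q^(n+1+r)`, one has `1 - x * y = (1 - x) * (1 - y) + y * (1 - x) +
x * (1 - y)`. The first piece gives the summand at `n`; the other two form `A r - A (r - 1)`, which
sums to zero. -/
theorem baileySum_step {Q : ℂ} (hQ : ‖Q‖ < 1) (hQ0 : Q ≠ 0) (n : ℤ) :
    (1 - Q ^ (2 * n + 2)) * baileySum Q (n + 1) = baileySum Q n := by
  set A : ℤ → ℂ := fun r => (-1) ^ r * Q ^ (r ^ 2 + r + n + 1) *
    (invPoch Q (n - r) * invPoch Q (n + 1 + r)) with hA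
  have key (r : ℤ) : (1 - Q ^ (2 * n + 2)) * ((-1) ^ r * Q ^ (r ^ 2) *
      (invPoch Q (n + 1 - r) * invPoch Q (n + 1 + r))) =
      (-1) ^ r * Q ^ (r ^ 2) * (invPoch Q (n - r) * invPoch Q (n + r)) + (A r - A (r - 1)) := by
    have a1 := invPoch_sub_one hQ (n + 1 - r)
    have a2 := invPoch_sub_one hQ (n + 1 + r)
    rw [show n + 1 - r - 1 = n - r by ring] at a1
    rw [show n + 1 + r - 1 = n + r by ring] at a2
    simp only [hA]
    rw [show n - (r - 1) = n + 1 - r by ring, show n + 1 + (r - 1) = n + r by ring, a1, a2]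
    have e1 : Q ^ (2 * n + 2) = Q ^ (n + 1 - r) * Q ^ (n + 1 + r) := by
      rw [← zpow_add₀ hQ0]; congr 1; ring
    have e2 : Q ^ (r ^ 2 + r + n + 1) = Q ^ (r ^ 2) * Q ^ (n + 1 + r) := by
      rw [← zpow_add₀ hQ0]; congr 1; ring
    have e3 : Q ^ ((r - 1) ^ 2 + (r - 1) + n + 1) = Q ^ (r ^ 2) * Q ^ (n + 1 - r) := by
      rw [← zpow_add₀ hQ0]; congr 1; ring
    have e4 : (-1 : ℂ) ^ (r - 1) = -(-1) ^ r := by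
      rw [zpow_sub_one₀ (by norm_num)]; norm_num
    rw [e1, e2, e3, e4]
    ring
  have s0 := summable_mul_invPoch Q (fun r => (-1) ^ r * Q ^ (r ^ 2)) n n
  have s1 : Summable A :=
    summable_mul_invPoch Q (fun r => (-1) ^ r * Q ^ (r ^ 2 + r + n + 1)) n (n + 1)
  have s2 : Summable fun r => A (r - 1) := (Equiv.subRight (1 : ℤ)).summable_iff.2 s1
  have hs : ∑' r, A (r - 1) = ∑' r, A r := (Equiv.subRight (1 : ℤ)).tsum_eq A
  rw [baileySum, ← tsum_mul_left, tsum_congr key, s0.tsum_add (s1.sub s2), s1.tsum_sub s2, hs,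
    sub_self, add_zero, baileySum]

theorem baileySum_natCast {Q : ℂ} (hQ : ‖Q‖ < 1) (hQ0 : Q ≠ 0) (n : ℕ) :
    baileySum Q n = (qPoch (Q ^ 2) (Q ^ 2) n)⁻¹ := by
  have hd := qPoch_self_ne_zero (norm_sq_lt_one hQ)
  induction n with
  | zero =>
    rw [baileySum, tsum_eq_single 0]
    · simp [invPoch, qPoch]
    · intro r hr
      rcases lt_or_gt_of_ne hr with h | h
      · simp [invPoch_of_neg _ h]
      · simp [invPoch_of_neg _ (show -r < 0 by omega)]
  | succ n ih =>
    have h := baileySum_step hQ hQ0 n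
    have z : Q ^ (2 * (n : ℤ) + 2) = Q ^ 2 * (Q ^ 2) ^ n := by
      rw [← pow_mul, ← pow_add, ← zpow_natCast]; congr 1; push_cast; ring
    have e : qPoch (Q ^ 2) (Q ^ 2) (n + 1) = qPoch (Q ^ 2) (Q ^ 2) n * (1 - Q ^ 2 * (Q ^ 2) ^ n) := by
      simp [qPoch, Finset.prod_range_succ]
    rw [z, ih] at h
    rw [Nat.cast_succ, ← mul_eq_one_iff_eq_inv₀ (hd _), e]
    linear_combination qPoch (Q ^ 2) (Q ^ 2) n * h + inv_mul_cancel₀ (hd n)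

/-! ### Conjugate Bailey pair -/

/-- The numerator of the summand of the series. -/
noncomputable def slaterCoeff (q : ℂ) (n : ℕ) : ℂ := qPoch q (q ^ 2) n * (-1) ^ n * q ^ n ^ 2

theorem slaterCoeff_succ (q : ℂ) (n : ℕ) :
    slaterCoeff q (n + 1) = -(1 - q ^ (2 * n + 1)) * q ^ (2 * n + 1) * slaterCoeff q n := by
  simp only [slaterCoeff, qPoch, Finset.prod_range_succ]
  ring

theorem exists_qPoch_bound (a : ℂ) {q : ℂ} (hq : ‖q‖ < 1) : ∃ B : ℝ, ∀ n, ‖qPoch a q n‖ ≤ B := by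
  obtain ⟨B, hB⟩ := (tendsto_qPoch a hq).norm.bddAbove_range
  exact ⟨B, fun n => hB ⟨n, rfl⟩⟩

theorem summable_norm_slaterCoeff {q : ℂ} (hq : ‖q‖ < 1) :
    Summable fun n => ‖slaterCoeff q n‖ := by
  obtain ⟨B, hB⟩ := exists_qPoch_bound q (norm_sq_lt_one hq)
  refine ((summable_geometric_of_lt_one (norm_nonneg q) hq).mul_left B).of_nonneg_of_le
    (fun _ => norm_nonneg _) fun n => ?_
  simp only [slaterCoeff, norm_mul, norm_pow, norm_neg, norm_one, one_pow, mul_one]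
  exact mul_le_mul (hB n)
    (pow_le_pow_of_le_one (norm_nonneg q) hq.le (Nat.le_self_pow two_ne_zero n))
    (by positivity) ((norm_nonneg _).trans (hB 0))

/-- The conjugate Bailey sum. -/
noncomputable def conjSum (q : ℂ) (r : ℤ) : ℂ :=
  ∑' n : ℕ, slaterCoeff q n * (invPoch (q ^ 2) (n - r) * invPoch (q ^ 2) (n + r))

theorem summable_slaterCoeff_mul {q : ℂ} (hq : ‖q‖ < 1) (a b : ℤ) :
    Summable fun n : ℕ => slaterCoeff q n * (invPoch (q ^ 2) (n + a) * invPoch (q ^ 2) (n + b)) := by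
  obtain ⟨B, hB⟩ := exists_invPoch_bound (norm_sq_lt_one hq)
  refine Summable.of_norm_bounded ((summable_norm_slaterCoeff hq).mul_right (B * B)) fun n => ?_
  rw [norm_mul, norm_mul]
  gcongr
  · exact (norm_nonneg _).trans (hB 0)
  · exact hB _
  · exact hB _

theorem conjSum_neg (q : ℂ) (r : ℤ) : conjSum q (-r) = conjSum q r := by
  refine tsum_congr fun n => ?_
  rw [sub_neg_eq_add, ← sub_eq_add_neg, mul_comm (invPoch _ _)]

theorem conjSum_succ {q : ℂ} (hq : ‖q‖ < 1) (hq0 : q ≠ 0) (r : ℕ) :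
    conjSum q (r + 1) = -q ^ (2 * r + 1) * conjSum q r := by
  have hQ := norm_sq_lt_one hq
  -- The telescoping certificate in `n`; it vanishes at `n = 0` because `-r - 1 < 0`.
  set G : ℕ → ℂ := fun n => -(1 + q ^ (2 * r + 1)) *
    (slaterCoeff q n * (invPoch (q ^ 2) (n - r - 1) * invPoch (q ^ 2) (n + r))) with hG
  have key (n : ℕ) : slaterCoeff q n *
      (invPoch (q ^ 2) (n - (r + 1)) * invPoch (q ^ 2) (n + (r + 1))) =
      -q ^ (2 * r + 1) * (slaterCoeff q n *
        (invPoch (q ^ 2) (n - r) * invPoch (q ^ 2) (n + r))) + (G (n + 1) - G n) := by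
    have a1 := invPoch_sub_one hQ (n - r)
    have a2 := invPoch_sub_one hQ (n + r + 1)
    rw [add_sub_cancel_right] at a2
    simp only [hG, slaterCoeff_succ]
    push_cast
    rw [show (n : ℤ) - (r + 1) = n - r - 1 by ring, show (n : ℤ) + 1 - r - 1 = n - r by ring,
      show (n : ℤ) + 1 + r = n + r + 1 by ring, ← add_assoc, a1, a2]
    have e1 : q ^ (2 * r + 1) * (q ^ 2) ^ ((n : ℤ) - r) = q ^ (2 * n + 1) := by
      rw [← zpow_natCast q (2 * r + 1), ← zpow_natCast q (2 * n + 1), ← zpow_natCast q 2,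
        ← zpow_mul, ← zpow_add₀ hq0]
      congr 1; push_cast; ring
    have e2 : (q ^ 2) ^ ((n : ℤ) + r + 1) = q ^ (2 * n + 1) * q ^ (2 * r + 1) := by
      rw [← pow_add, ← zpow_natCast q (2 * n + 1 + _), ← zpow_natCast q 2, ← zpow_mul]
      congr 1; push_cast; ring
    rw [e2, ← e1]
    ring
  have s0 := summable_slaterCoeff_mul hq (-r) r
  have s1 : Summable G := by
    refine ((summable_slaterCoeff_mul hq (-r - 1) r).mul_left (-(1 + q ^ (2 * r + 1)))).congr
      fun n => ?_
    simp only [hG, sub_eq_add_neg, add_assoc]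
  simp only [← sub_eq_add_neg] at s0
  have s2 : Summable fun n => G (n + 1) := (summable_nat_add_iff 1).2 s1
  have hs := s1.tsum_eq_zero_add
  have h0 : G 0 = 0 := by
    simp [hG, invPoch_of_neg (q ^ 2) (show -(r : ℤ) - 1 < 0 by omega)]
  rw [h0, zero_add] at hs
  rw [conjSum, tsum_congr key, (s0.mul_left _).tsum_add (s2.sub s1), s2.tsum_sub s1, ← hs, sub_self,
    add_zero, tsum_mul_left, conjSum]

theorem conjSum_natCast {q : ℂ} (hq : ‖q‖ < 1) (hq0 : q ≠ 0) (r : ℕ) :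
    conjSum q r = (-1) ^ r * q ^ r ^ 2 * conjSum q 0 := by
  induction r with
  | zero => simp
  | succ r ih =>
    rw [Nat.cast_succ, conjSum_succ hq hq0, ih]
    ring

/-- The shifted conjugate Bailey sum, in which the index starts at the first non-zero term. -/
theorem conjSum_eq_shifted {q : ℂ} (hq : ‖q‖ < 1) (r : ℕ) :
    conjSum q r = (-1) ^ r * q ^ r ^ 2 * ∑' m : ℕ, qPoch q (q ^ 2) (m + r) *
      ((-1) ^ m * q ^ (m ^ 2 + 2 * m * r)) *
      (invPoch (q ^ 2) m * invPoch (q ^ 2) (m + 2 * r : ℕ)) := by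
  have s := summable_slaterCoeff_mul hq (-r) r
  rw [conjSum, ← tsum_mul_left]
  simp only [← sub_eq_add_neg] at s
  rw [← s.sum_add_tsum_nat_add r, Finset.sum_eq_zero, zero_add]
  · refine tsum_congr fun m => ?_
    rw [show ((m + r : ℕ) : ℤ) - r = m by push_cast; ring,
      show ((m + r : ℕ) : ℤ) + r = (m + 2 * r : ℕ) by push_cast; ring, slaterCoeff]
    ring
  · intro n hn
    rw [Finset.mem_range] at hn
    simp [invPoch_of_neg (q ^ 2) (show (n : ℤ) - r < 0 by omega)]

/-- By `conjSum_natCast` the shifted sum in `conjSum_eq_shifted` does not depend on `r`. As `r → ∞`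
the factor `q^(2mr)` kills every term except `m = 0`, whose limit is the quotient of infinite
products. -/
theorem conjSum_zero {q : ℂ} (hq : ‖q‖ < 1) (hq0 : q ≠ 0) :
    conjSum q 0 = qPochInf q (q ^ 2) / qPochInf (q ^ 2) (q ^ 2) := by
  have hQ := norm_sq_lt_one hq
  obtain ⟨B, hB⟩ := exists_invPoch_bound hQ
  obtain ⟨C, hC⟩ := exists_qPoch_bound q hQ
  have hB0 := (norm_nonneg _).trans (hB 0)
  have hC0 := (norm_nonneg _).trans (hC 0)
  set f : ℕ → ℕ → ℂ := fun r m => qPoch q (q ^ 2) (m + r) *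
      ((-1) ^ m * q ^ (m ^ 2 + 2 * m * r)) *
      (invPoch (q ^ 2) m * invPoch (q ^ 2) (m + 2 * r : ℕ)) with hf
  have hconst (r : ℕ) : ∑' m, f r m = conjSum q 0 := by
    have h1 := conjSum_eq_shifted hq r
    rw [conjSum_natCast hq hq0 r] at h1
    exact (mul_left_cancel₀ (by simp [hq0]) h1).symm
  set L : ℂ := qPochInf q (q ^ 2) / qPochInf (q ^ 2) (q ^ 2) with hL
  have hlim : Tendsto (fun r => ∑' m, f r m) atTop (𝓝 (∑' m : ℕ, if m = 0 then L else 0)) := by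
    refine tendsto_tsum_of_dominated_convergence (bound := fun m => C * ‖q‖ ^ m * (B * B))
      (((summable_geometric_of_lt_one (norm_nonneg q) hq).mul_left C).mul_right _)
      (fun m => ?_) (.of_forall fun r m => ?_)
    · have t1 : Tendsto (fun r => qPoch q (q ^ 2) (m + r)) atTop (𝓝 (qPochInf q (q ^ 2))) :=
        (tendsto_qPoch q hQ).comp (tendsto_atTop_mono (fun r => Nat.le_add_left r m) tendsto_id)
      have t2 : Tendsto (fun r : ℕ => invPoch (q ^ 2) (m + 2 * r : ℕ)) atTop
          (𝓝 (qPochInf (q ^ 2) (q ^ 2))⁻¹) :=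
        (tendsto_invPoch hQ).comp
          (tendsto_atTop_mono (fun r => by simp only [id]; omega) tendsto_id)
      rcases Nat.eq_zero_or_pos m with rfl | hm
      · have := t1.mul t2
        simpa [hf, hL, div_eq_mul_inv, invPoch, qPoch] using this
      · have t3 : Tendsto (fun r => q ^ (m ^ 2 + 2 * m * r)) atTop (𝓝 0) :=
          (tendsto_pow_atTop_nhds_zero_of_norm_lt_one hq).comp
            (tendsto_atTop_mono (fun r => by simp only [id]; nlinarith) tendsto_id)
        have := (t1.mul (t3.const_mul ((-1) ^ m))).mul (t2.const_mul (invPoch (q ^ 2) m))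
        simpa [hf, hm.ne'] using this
    · simp only [hf, norm_mul, norm_pow, norm_neg, norm_one, one_pow, one_mul]
      have hp : ‖q‖ ^ (m ^ 2 + 2 * m * r) ≤ ‖q‖ ^ m :=
        pow_le_pow_of_le_one (norm_nonneg q) hq.le
          ((Nat.le_self_pow two_ne_zero m).trans (Nat.le_add_right _ _))
      have h1 := hC (m + r)
      have h2 := hB m
      have h3 := hB (m + 2 * r : ℕ)
      exact mul_le_mul (mul_le_mul h1 hp (by positivity) hC0)
        (mul_le_mul h2 h3 (norm_nonneg _) hB0) (by positivity) (by positivity)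
  simp only [hconst, tsum_ite_eq] at hlim
  exact tendsto_nhds_unique tendsto_const_nhds hlim

theorem conjSum_eq {q : ℂ} (hq : ‖q‖ < 1) (hq0 : q ≠ 0) (r : ℤ) :
    conjSum q r = (-1) ^ r * q ^ (r ^ 2) *
      (qPochInf q (q ^ 2) / qPochInf (q ^ 2) (q ^ 2)) := by
  rw [← conjSum_zero hq hq0]
  have h (n : ℕ) : conjSum q n = (-1 : ℂ) ^ (n : ℤ) * q ^ ((n : ℤ) ^ 2) * conjSum q 0 := by
    rw [conjSum_natCast hq hq0, ← Nat.cast_pow, zpow_natCast, zpow_natCast]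
  obtain ⟨n, rfl | rfl⟩ := r.eq_nat_or_neg
  · exact h n
  · rw [conjSum_neg, h, neg_sq, zpow_neg, ← inv_zpow, inv_neg_one]

/-! ### Reduction to a theta series -/

theorem slater_theta {q : ℂ} (hq : ‖q‖ < 1) (hq0 : q ≠ 0) :
    ∑' n : ℕ, qPoch q (q ^ 2) n * (-1) ^ n * q ^ n ^ 2 / qPoch (q ^ 4) (q ^ 4) n =
      qPochInf q (q ^ 2) / qPochInf (q ^ 2) (q ^ 2) * ∑' r : ℤ, (q ^ 3) ^ (r ^ 2) := by
  have hQ := norm_sq_lt_one hq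
  obtain ⟨B, hB⟩ := exists_invPoch_bound hQ
  set F : ℕ → ℤ → ℂ := fun n r => slaterCoeff q n * ((-1) ^ r * (q ^ 2) ^ (r ^ 2) *
    (invPoch (q ^ 2) (n - r) * invPoch (q ^ 2) (n + r))) with hF
  have hs : Summable (Function.uncurry F) := by
    have hb := ((summable_norm_slaterCoeff hq).mul_of_nonneg (summable_norm_pow_sq hQ)
      (fun _ => norm_nonneg _) (fun _ => norm_nonneg _)).mul_right (B * B)
    refine Summable.of_norm_bounded hb fun x => ?_
    have hx : ‖(-1 : ℂ) ^ x.2‖ = 1 := by simp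
    simp only [Function.uncurry, hF, norm_mul, hx, one_mul]
    rw [mul_assoc]
    gcongr
    · exact (norm_nonneg _).trans (hB 0)
    · exact hB _
    · exact hB _
  calc _ = ∑' (n : ℕ) (r : ℤ), F n r := by
        refine tsum_congr fun n => ?_
        simp only [hF]
        rw [tsum_mul_left, ← baileySum, baileySum_natCast hQ (pow_ne_zero 2 hq0), ← pow_mul]
        rfl
    _ = ∑' (r : ℤ) (n : ℕ), F n r := hs.tsum_comm.symm
    _ = _ := by
        rw [← tsum_mul_left]
        refine tsum_congr fun r => ?_
        have h : ∑' n, F n r = (-1) ^ r * (q ^ 2) ^ (r ^ 2) * conjSum q r := by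
          rw [conjSum, ← tsum_mul_left]
          exact tsum_congr fun n => by simp only [hF]; ring
        -- The signs of the Bailey pair and its conjugate cancel, while the exponents `2 * r^2` and
        -- `r^2` add.
        have h1 : (-1 : ℂ) ^ r * (-1) ^ r = 1 := by rw [← mul_zpow]; simp
        have h3 : (q ^ 3) ^ (r ^ 2) = (q ^ 2) ^ (r ^ 2) * q ^ (r ^ 2) := by
          rw [← mul_zpow, ← pow_succ]
        rw [h, conjSum_eq hq hq0, h3]
        linear_combination ((q ^ 2) ^ (r ^ 2) * q ^ (r ^ 2) *
          (qPochInf q (q ^ 2) / qPochInf (q ^ 2) (q ^ 2))) * h1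

/-! ### Rearrangement of the infinite products -/

theorem qPochInf_trisect (a : ℂ) {q : ℂ} (hq : ‖q‖ < 1) :
    qPochInf a q =
      qPochInf a (q ^ 3) * qPochInf (a * q) (q ^ 3) * qPochInf (a * q ^ 2) (q ^ 3) := by
  have h3 : ‖q ^ 3‖ < 1 := by
    rw [norm_pow]; exact pow_lt_one₀ (norm_nonneg q) hq three_ne_zero
  have h (n : ℕ) : qPoch a q (3 * n) =
      qPoch a (q ^ 3) n * qPoch (a * q) (q ^ 3) n * qPoch (a * q ^ 2) (q ^ 3) n := by
    induction n with
    | zero => simp [qPoch]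
    | succ n ih =>
      simp only [qPoch, mul_add, mul_one, Finset.prod_range_succ] at ih ⊢
      rw [ih]
      ring
  have t := (tendsto_qPoch a hq).comp (tendsto_id.const_mul_atTop' three_pos)
  refine tendsto_nhds_unique t ?_
  refine (((tendsto_qPoch a h3).mul (tendsto_qPoch (a * q) h3)).mul
    (tendsto_qPoch (a * q ^ 2) h3)).congr fun n => (h n).symm

theorem qPochInf_mul_neg (a : ℂ) {q : ℂ} (hq : ‖q‖ < 1) :
    qPochInf a q * qPochInf (-a) q = qPochInf (a ^ 2) (q ^ 2) := by
  refine tendsto_nhds_unique ((tendsto_qPoch a hq).mul (tendsto_qPoch (-a) hq)) ?_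
  refine (tendsto_qPoch (a ^ 2) (norm_sq_lt_one hq)).congr fun n => ?_
  rw [qPoch, qPoch, qPoch, ← Finset.prod_mul_distrib]
  exact Finset.prod_congr rfl fun i _ => by ring

/-- Base `q^2` is split into base `q^6`, the factor `(q^6;q^6)_∞` cancels, and `(q^3;q^6)_∞
(-q^3;q^6)_∞ = (q^6;q^12)_∞` absorbs the theta factor. -/
theorem slater_product {q : ℂ} (hq : ‖q‖ < 1) :
    qPochInf q (q ^ 2) / qPochInf (q ^ 2) (q ^ 2) *
        (qPochInf (-q ^ 3) (q ^ 6) ^ 2 * qPochInf (q ^ 6) (q ^ 6)) =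
      (qPochInf q (q ^ 6) * qPochInf (q ^ 5) (q ^ 6) * qPochInf (q ^ 6) (q ^ 12) ^ 2) /
        (qPochInf (q ^ 2) (q ^ 6) * qPochInf (q ^ 3) (q ^ 6) * qPochInf (q ^ 4) (q ^ 6)) := by
  have h6 : ‖q ^ 6‖ < 1 := by
    rw [norm_pow]; exact pow_lt_one₀ (norm_nonneg q) hq (by norm_num)
  have e1 := qPochInf_trisect q (norm_sq_lt_one hq)
  have e2 := qPochInf_trisect (q ^ 2) (norm_sq_lt_one hq)
  have e3 := qPochInf_mul_neg (q ^ 3) h6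
  simp only [← pow_mul, ← pow_add, ← pow_succ', Nat.reduceMul, Nat.reduceAdd] at e1 e2 e3
  have n2 := qPochInf_ne_zero hq (r := 2) (m := 6) (by norm_num) (by norm_num)
  have n3 := qPochInf_ne_zero hq (r := 3) (m := 6) (by norm_num) (by norm_num)
  have n4 := qPochInf_ne_zero hq (r := 4) (m := 6) (by norm_num) (by norm_num)
  have n6 := qPochInf_ne_zero hq (r := 6) (m := 6) (by norm_num) (by norm_num)
  rw [e1, e2, ← e3]
  field_simp

theorem slater_identity {q : ℂ} (hq : ‖q‖ < 1) :
    ∑' n : ℕ, qPoch q (q ^ 2) n * (-1) ^ n * q ^ n ^ 2 / qPoch (q ^ 4) (q ^ 4) n =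
      (qPochInf q (q ^ 6) * qPochInf (q ^ 5) (q ^ 6) * qPochInf (q ^ 6) (q ^ 12) ^ 2) /
        (qPochInf (q ^ 2) (q ^ 6) * qPochInf (q ^ 3) (q ^ 6) * qPochInf (q ^ 4) (q ^ 6)) := by
  -- The recurrences add integer exponents of `q`, which needs `q ≠ 0`; at `q = 0` only the term `n
  -- = 0` survives.
  rcases eq_or_ne q 0 with rfl | hq0
  · rw [tsum_eq_single 0 fun n hn => by simp [hn]]
    simp [qPoch, qPochInf]
  · have h3 : ‖q ^ 3‖ < 1 := by
      rw [norm_pow]; exact pow_lt_one₀ (norm_nonneg q) hq three_ne_zero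
    rw [slater_theta hq hq0, tsum_pow_sq h3 (pow_ne_zero 3 hq0), ← pow_mul,
      ← slater_product hq]

end SlaterFour

theorem mainTheorem3 (q : ℂ) (hq : ‖q‖ < 1) :
    Summable (fun l : SlaterFour.P4 =>
      (-1 : ℂ) ^ SlaterFour.oddParts (l : List ℕ) * q ^ (l : List ℕ).sum) ∧
    Summable (fun n : ℕ =>
      SlaterFour.qPoch q (q ^ 2) n * (-1) ^ n * q ^ n ^ 2 / SlaterFour.qPoch (q ^ 4) (q ^ 4) n) ∧
    ∑' l : SlaterFour.P4,
        (-1 : ℂ) ^ SlaterFour.oddParts (l : List ℕ) * q ^ (l : List ℕ).sum =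
      ∑' n : ℕ,
        SlaterFour.qPoch q (q ^ 2) n * (-1) ^ n * q ^ n ^ 2 /
          SlaterFour.qPoch (q ^ 4) (q ^ 4) n ∧
    ∑' n : ℕ,
        SlaterFour.qPoch q (q ^ 2) n * (-1) ^ n * q ^ n ^ 2 /
          SlaterFour.qPoch (q ^ 4) (q ^ 4) n =
      (SlaterFour.qPochInf q (q ^ 6) * SlaterFour.qPochInf (q ^ 5) (q ^ 6) *
          SlaterFour.qPochInf (q ^ 6) (q ^ 12) ^ 2) /
        (SlaterFour.qPochInf (q ^ 2) (q ^ 6) * SlaterFour.qPochInf (q ^ 3) (q ^ 6) *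
          SlaterFour.qPochInf (q ^ 4) (q ^ 6)) :=
  ⟨SlaterFour.summable_partitions hq, SlaterFour.summable_slaterTerm hq,
    SlaterFour.tsum_partitions hq, SlaterFour.slater_identity hq⟩
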